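/- Let $\mathfrak g$ be a semisimple simply-laced Lie algebra with simple roots $\alpha_j$ ($j\in I$), fundamental coweights $\varpi_j$ ($\langle\varpi_i,\alpha_j\rangle=\delta_{ij}$), coweight lattice $\Lambda$, and Weyl group $W$ acting on $\Lambda$. (Only the root system matters, so one may start from any finite reduced crystallographic simply-laced root system with a base.) Write $i\sim j$ if $i,j$ are distinct and connected in the Dynkin diagram, and fix a bipartition $I=I_{\bar 0}\sqcup I_{\bar 1}$ of the Dynkin diagram; $i\in I$ and $k\in\mathbb Z$ have the same parity if $i\in I_{\bar k}$. Let $\mathcal B$ be the set of Laurent monomials in the variables $y_{i,k}$, $i\in I$, $k\in\mathbb Z$ of the same parity. Put $z_{i,k}=y_{i,k}\,y_{i,k+2}\prod_{j\sim i}y_{j,k+1}^{-1}$. For $p=\prod y_{i,k}^{a_{i,k}}$ put $wt(p)=\sum_{i,k}a_{i,k}\varpi_i$, $\varepsilon_i^k(p)=-\sum_{l\le k}a_{i,l}$, $\varphi_i^k(p)=\sum_{l\ge k}a_{i,l}$, $\varepsilon_i(p)=\max_k\varepsilon_i^k(p)$ and $\varphi_i(p)=\max_k\varphi_i^k(p)$,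 where $k$ runs over the integers of the same parity as $i$. Let $\tilde e_i(p)=0$ if $\varepsilon_i(p)=0$, and otherwise $\tilde e_i(p)=z_{i,k}\,p$ with $k$ the smallest integer of the same parity as $i$ such that $\varepsilon_i^k(p)=\varepsilon_i(p)$. Let $\tilde f_i(p)=0$ if $\varphi_i(p)=0$, and otherwise $\tilde f_i(p)=z_{i,k-2}^{-1}\,p$ with $k$ the largest integer of the same parity as $i$ such that $\varphi_i^k(p)=\varphi_i(p)$. For $c\in\mathbb Z$ of the same parity as $i$, let $\mathcal B(\varpi_i,c)\subset\mathcal B$ be the smallest set that contains $y_{i,c}$ and is stable under all nonzero values of the $\tilde e_j,\tilde f_j$. For arbitrary $c\in\mathbb C$, let $\mathcal B(\varpi_i,c)$ be obtained from $\mathcal B(\varpi_i,c_0)$, where $c_0$ is an integer of the same parity as $i$, by the translation $y_{j,k}\mapsto y_{j,k+c-c_0}$; the weight of a monomial is given by the same formula. For a positive root $\beta$ let $h(\beta)=\langle\rho^\vee,\beta\rangle$, where $\rho^\vee=\sum_j\varpi_j$; for any root $\beta$ let $h(\pm\beta)$ be $h(\beta)$ if $\beta$ is positive and $h(-\beta)$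 if $\beta$ is negative. **Proposition.** Let $i\in I$ be such that $\varpi_i$ is minuscule, i.e. $\langle\varpi_i,\beta\rangle\in\{-1,0,1\}$ for all roots $\beta$. Let $\gamma\in W\varpi_i$ and let $w\in W$ be of minimal length such that $w\varpi_i=\gamma$. Then for every integer $c$ of the same parity as $i$, and more generally for every $c\in\mathbb C$, the crystal $\mathcal B(\varpi_i,c)$ contains exactly one monomial of weight $\gamma$, namely $$y_{\gamma,c}=\prod_{j\in I}y_{j,\;c-h(\pm w^{-1}\alpha_j)+\langle\gamma,\alpha_j\rangle}^{\langle\gamma,\alpha_j\rangle}.$$ -/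

import Mathlib

/-!
Monomial crystals attached to a finite root system.

Throughout, `P` is a root system (for instance the root system of a semisimple Lie algebra `𝔤` with
respect to a Cartan subalgebra), with roots in `M` and coroots in `N`, and `b` is a base of `P`.
The Dynkin nodes are the elements of `b.support`, and `α_j` is `P.root j`. Coweights live in `N`.
-/

noncomputable section

namespace MonomialCrystal

open RootPairing

section Coweights

variable {ι K M N : Type*} [Field K] [AddCommGroup M] [Module K M]
  [AddCommGroup N] [Module K N]

/-- The coweight lattice `Λ`: the elements of `N` that pair integrally with every root. -/
def coweightLattice (P : RootPairing ι K M N) : AddSubgroup N where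
  carrier := {x | ∀ k : ι, ∃ n : ℤ, P.toLinearMap (P.root k) x = (n : K)}
  zero_mem' := fun _ => ⟨0, by simp⟩
  add_mem' := by
    intro x y hx hy k
    obtain ⟨m, hm⟩ := hx k
    obtain ⟨n, hn⟩ := hy k
    exact ⟨m + n, by simp [hm, hn]⟩
  neg_mem' := by
    intro x hx k
    obtain ⟨m, hm⟩ := hx k
    exact ⟨-m, by simp [hm]⟩

/-- The integer `⟨x, α_k⟩`, for a coweight `x` and a root `α_k`. -/
def pairing {P : RootPairing ι K M N} (x : coweightLattice P) (k : ι) : ℤ :=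
  (x.2 k).choose

theorem pairing_spec {P : RootPairing ι K M N} (x : coweightLattice P) (k : ι) :
    P.toLinearMap (P.root k) (x : N) = (pairing x k : K) :=
  (x.2 k).choose_spec

theorem toLinearMap_op_smul {P : RootPairing ι K M N} (w : P.Aut) (m : M) (x : N) :
    P.toLinearMap m (MulOpposite.op w • x) = P.toLinearMap (w • m) x := by
  exact (congrArg (fun f => f x m) w.weight_coweight_transpose).symm

/-- The action of the Weyl group on coweights, contragredient to its action on the roots:
`⟨w x, α⟩ = ⟨x, w⁻¹ α⟩`. -/
instance (P : RootPairing ι K M N) : SMul P.weylGroup (coweightLattice P) where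
  smul w x := ⟨MulOpposite.op (w⁻¹ : P.Aut) • (x : N), by
    intro k
    obtain ⟨n, hn⟩ := x.2 ((w⁻¹ : P.Aut) • k)
    refine ⟨n, ?_⟩
    rw [toLinearMap_op_smul, ← hn, ← Equiv.root_indexEquiv_eq_smul]
    rfl⟩

theorem pairing_smul [CharZero K] {P : RootPairing ι K M N} (w : P.weylGroup) (x : coweightLattice P) (k : ι) :
    pairing (w • x) k = pairing x (w⁻¹ • k) := by
  have h : (pairing (w • x) k : K) = pairing x (w⁻¹ • k) := by
    rw [← pairing_spec, ← pairing_spec]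
    change P.toLinearMap (P.root k) (MulOpposite.op (w⁻¹ : P.Aut) • (x : N)) = _
    rw [toLinearMap_op_smul, ← Equiv.root_indexEquiv_eq_smul]
    rfl
  exact_mod_cast h

variable {P : RootPairing ι K M N} [P.IsRootSystem] (b : P.Base)

/-- The fundamental coweight `ϖ_i` as an element of `N`. -/
def fundamentalCoweightVec (i : b.support) : N :=
  P.flip.toPerfPair.symm (b.toWeightBasis.coord i)

theorem toLinearMap_fundamentalCoweightVec (i : b.support) (m : M) :
    P.toLinearMap m (fundamentalCoweightVec b i) = b.toWeightBasis.coord i m := by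
  have h := LinearEquiv.apply_symm_apply P.flip.toPerfPair (b.toWeightBasis.coord i)
  exact congrArg (fun f => f m) h

variable [CharZero K]

/-- The fundamental coweight `ϖ_i`, characterised by `⟨ϖ_i, α_j⟩ = δ_ij`. -/
def fundamentalCoweight (i : b.support) : coweightLattice P :=
  ⟨fundamentalCoweightVec b i, by
    intro k
    obtain ⟨f, -, -, hf⟩ := b.exists_root_eq_sum_int k
    refine ⟨f i, ?_⟩
    rw [toLinearMap_fundamentalCoweightVec, hf,
      b.support.sum_subtype (p := (· ∈ b.support)) (by simp) (F := inferInstance), map_sum,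
      Finset.sum_eq_single i]
    · rw [← b.toWeightBasis_apply, map_zsmul]
      simp
    · intro j _ hj
      rw [← b.toWeightBasis_apply, map_zsmul]
      simp [hj]
    · simp⟩

theorem pairing_fundamentalCoweight (i j : b.support) [Decidable (i = j)] :
    pairing (fundamentalCoweight b i) j = if i = j then 1 else 0 := by
  have h : (pairing (fundamentalCoweight b i) j : K) = ((if i = j then 1 else 0 : ℤ) : K) := by
    rw [← pairing_spec]
    change P.toLinearMap _ (fundamentalCoweightVec b i) = _
    rw [toLinearMap_fundamentalCoweightVec, ← b.toWeightBasis_apply]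
    split_ifs with hij
    · simp [hij]
    · simp [Ne.symm hij]
  exact_mod_cast h

/-- `ϖ_i` is minuscule: `⟨ϖ_i, β⟩ ∈ {-1, 0, 1}` for all roots `β`. -/
def IsMinuscule (i : b.support) : Prop :=
  ∀ k : ι, pairing (fundamentalCoweight b i) k ∈ ({-1, 0, 1} : Set ℤ)

/-- `ρ^∨`, the sum of the fundamental coweights. -/
def rhoCheck : coweightLattice P := ∑ j : b.support, fundamentalCoweight b j

open Classical in
/-- `h(±β)` for the root `β = P.root k`: it is `h(β)` if `β` is positive and `h(-β)` if `β` is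
negative, where `h = ⟨ρ^∨, ·⟩`. -/
def hpm (k : ι) : ℤ :=
  if b.IsPos k then pairing (rhoCheck b) k else pairing (rhoCheck b) (P.reflectionPerm k k)

end Coweights

section WeylGroup

variable {ι K M N : Type*} [Field K] [AddCommGroup M] [Module K M]
  [AddCommGroup N] [Module K N] {P : RootPairing ι K M N} (b : P.Base)

/-- The length of an element of the Weyl group: the least length of a word in the simple
reflections representing it. -/
def length (w : P.weylGroup) : ℕ :=
  sInf {n | ∃ l : List b.support, l.length = n ∧
    (l.map fun j => weylGroup.ofIdx P (j : ι)).prod = w}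

theorem exists_word [CharZero K] [Finite ι] [P.IsCrystallographic] [P.IsReduced]
    (w : P.weylGroup) :
    ∃ l : List b.support, (l.map fun j => weylGroup.ofIdx P (j : ι)).prod = w := by
  let S : Subgroup P.weylGroup :=
    Subgroup.closure (Set.range fun j : b.support => weylGroup.ofIdx P (j : ι))
  have hinv : ∀ i : ι, (weylGroup.ofIdx P i)⁻¹ = weylGroup.ofIdx P i := fun i =>
    Subtype.ext (Equiv.reflection_inv P i)
  have hrefl : ∀ i j : ι, weylGroup.ofIdx P (P.reflectionPerm j i) =
      weylGroup.ofIdx P j * weylGroup.ofIdx P i * weylGroup.ofIdx P j := by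
    intro i j
    refine Subtype.ext (Equiv.weightHom_injective P (LinearEquiv.ext fun x => ?_))
    change P.reflection (P.reflectionPerm j i) x =
      P.reflection j (P.reflection i (P.reflection j x))
    rw [reflection_reflectionPerm]
    rfl
  have hS : ∀ i : ι, weylGroup.ofIdx P i ∈ S := by
    intro i
    refine b.induction_reflect i (p := fun i => weylGroup.ofIdx P i ∈ S) ?_ ?_ ?_
    · intro i hi
      rw [hrefl]
      exact mul_mem (mul_mem hi hi) hi
    · intro i hi
      exact Subgroup.subset_closure ⟨⟨i, hi⟩, rfl⟩
    · intro i j hi hj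
      have hj' : weylGroup.ofIdx P j ∈ S := Subgroup.subset_closure ⟨⟨j, hj⟩, rfl⟩
      rw [hrefl]
      exact mul_mem (mul_mem hj' hi) hj'
  have hw : w ∈ S := by
    obtain ⟨w, hw⟩ := w
    exact weylGroup.induction P (pred := fun g hg => (⟨g, hg⟩ : P.weylGroup) ∈ S) hS
      (one_mem S) (fun x y hx hy h1 h2 => mul_mem h1 h2) hw
  induction hw using Subgroup.closure_induction'' with
  | one => exact ⟨[], rfl⟩
  | mem x hx =>
    obtain ⟨j, rfl⟩ := hx
    exact ⟨[j], by simp⟩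
  | inv_mem x hx =>
    obtain ⟨j, rfl⟩ := hx
    exact ⟨[j], by simp [hinv]⟩
  | mul x z _ _ hx hz =>
    obtain ⟨l, rfl⟩ := hx
    obtain ⟨l', rfl⟩ := hz
    exact ⟨l ++ l', by simp⟩

/-- `w` is minimal (of least length) such that `w x = γ`. -/
def IsMinimalTaking (w : P.weylGroup) (x γ : coweightLattice P) : Prop :=
  w • x = γ ∧ ∀ w' : P.weylGroup, w' • x = γ → length b w ≤ length b w'

variable [P.IsCrystallographic]

/-- `j ∼ i`: the nodes are distinct and connected in the Dynkin diagram. -/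
def Connected (j i : b.support) : Prop := j ≠ i ∧ b.cartanMatrix j i ≠ 0

/-- `par` is a bipartition of the Dynkin diagram into even and odd nodes. -/
def IsBipartition (par : b.support → ZMod 2) : Prop :=
  ∀ i j : b.support, Connected b j i → par j ≠ par i

end WeylGroup

section Monomials

/-- Laurent monomials in variables `y_{i,k}`, `i ∈ I`, `k ∈ A`, encoded by their exponents and
written multiplicatively. -/
abbrev Monomial (I A : Type*) := Multiplicative ((I × A) →₀ ℤ)

variable {I A : Type*}

/-- The exponent `a_{i,k}` of `y_{i,k}` in `p`. -/
def expo (p : Monomial I A) (i : I) (k : A) : ℤ := Multiplicative.toAdd p (i, k)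

/-- The variable `y_{i,k}`. -/
def y (i : I) (k : A) : Monomial I A := Multiplicative.ofAdd (Finsupp.single (i, k) 1)

/-- The translation `y_{i,k} ↦ y_{i,k+d}` from integrally to complex indexed monomials. -/
def translate (d : ℂ) : Monomial I ℤ →* Monomial I ℂ :=
  AddMonoidHom.toMultiplicative
    (Finsupp.mapDomain.addMonoidHom fun v : I × ℤ => (v.1, (v.2 : ℂ) + d))

/-- The set `𝓑` of all monomials in the `y_{i,k}` with `i` and `k` of the same parity. -/
def parityMonomials (par : I → ZMod 2) : Subgroup (Monomial I ℤ) where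
  carrier := {p | ∀ i k, expo p i k ≠ 0 → (k : ZMod 2) = par i}
  one_mem' := fun i k h => (h rfl).elim
  mul_mem' := by
    intro p q hp hq i k h
    by_cases h1 : expo p i k = 0
    · refine hq i k fun h2 => h ?_
      change expo p i k + expo q i k = 0
      rw [h1, h2, add_zero]
    · exact hp i k h1
  inv_mem' := by
    intro p hp i k h
    refine hp i k fun h1 => h ?_
    change - expo p i k = 0
    rw [h1, neg_zero]

open Classical in
/-- `ε_i^k(p) = - ∑_{l ≤ k} a_{i,l}`. -/
def epsAt (i : I) (k : ℤ) (p : Monomial I ℤ) : ℤ :=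
  -(Multiplicative.toAdd p).sum fun v a => if v.1 = i ∧ v.2 ≤ k then a else 0

open Classical in
/-- `φ_i^k(p) = ∑_{l ≥ k} a_{i,l}`. -/
def phiAt (i : I) (k : ℤ) (p : Monomial I ℤ) : ℤ :=
  (Multiplicative.toAdd p).sum fun v a => if v.1 = i ∧ k ≤ v.2 then a else 0

variable (par : I → ZMod 2)

/-- `ε_i(p) = max_k ε_i^k(p)`, over the `k` of the same parity as `i`. -/
def eps (i : I) (p : Monomial I ℤ) : ℤ :=
  sSup {n | ∃ k : ℤ, (k : ZMod 2) = par i ∧ epsAt i k p = n}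

/-- `φ_i(p) = max_k φ_i^k(p)`, over the `k` of the same parity as `i`. -/
def phi (i : I) (p : Monomial I ℤ) : ℤ :=
  sSup {n | ∃ k : ℤ, (k : ZMod 2) = par i ∧ phiAt i k p = n}

theorem exists_parity_ge (i : I) (m : ℤ) : ∃ k : ℤ, m ≤ k ∧ (k : ZMod 2) = par i := by
  have h : ∀ x y : ZMod 2, x = y ∨ x + 1 = y := by decide
  rcases h (m : ZMod 2) (par i) with h | h
  · exact ⟨m, le_rfl, h⟩
  · exact ⟨m + 1, by lia, by push_cast; exact h⟩

theorem exists_parity_le (i : I) (m : ℤ) : ∃ k : ℤ, k ≤ m ∧ (k : ZMod 2) = par i := by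
  have h : ∀ x y : ZMod 2, x = y ∨ x - 1 = y := by decide
  rcases h (m : ZMod 2) (par i) with h | h
  · exact ⟨m, le_rfl, h⟩
  · exact ⟨m - 1, by lia, by push_cast; exact h⟩

/-- The maximum defining `ε_i(p)` is attained. -/
theorem isGreatest_eps (i : I) (p : Monomial I ℤ) :
    IsGreatest {n | ∃ k : ℤ, (k : ZMod 2) = par i ∧ epsAt i k p = n} (eps par i p) := by
  classical
  have hfin : {n | ∃ k : ℤ, (k : ZMod 2) = par i ∧ epsAt i k p = n}.Finite := by
    refine ((Multiplicative.toAdd p).support.powerset.image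
      fun s => -∑ v ∈ s, Multiplicative.toAdd p v).finite_toSet.subset ?_
    rintro n ⟨k, -, rfl⟩
    simp only [Finset.coe_image, Set.mem_image, Finset.mem_coe, Finset.mem_powerset]
    exact ⟨(Multiplicative.toAdd p).support.filter fun v => v.1 = i ∧ v.2 ≤ k,
      Finset.filter_subset _ _, by rw [Finset.sum_filter]; rfl⟩
  obtain ⟨k, -, hk⟩ := exists_parity_ge par i 0
  have hne : {n | ∃ k : ℤ, (k : ZMod 2) = par i ∧ epsAt i k p = n}.Nonempty := ⟨_, k, hk, rfl⟩
  exact ⟨hne.csSup_mem hfin, fun _ h => le_csSup hfin.bddAbove h⟩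

/-- The maximum defining `φ_i(p)` is attained. -/
theorem isGreatest_phi (i : I) (p : Monomial I ℤ) :
    IsGreatest {n | ∃ k : ℤ, (k : ZMod 2) = par i ∧ phiAt i k p = n} (phi par i p) := by
  classical
  have hfin : {n | ∃ k : ℤ, (k : ZMod 2) = par i ∧ phiAt i k p = n}.Finite := by
    refine ((Multiplicative.toAdd p).support.powerset.image
      fun s => ∑ v ∈ s, Multiplicative.toAdd p v).finite_toSet.subset ?_
    rintro n ⟨k, -, rfl⟩
    simp only [Finset.coe_image, Set.mem_image, Finset.mem_coe, Finset.mem_powerset]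
    exact ⟨(Multiplicative.toAdd p).support.filter fun v => v.1 = i ∧ k ≤ v.2,
      Finset.filter_subset _ _, by rw [Finset.sum_filter]; rfl⟩
  obtain ⟨k, -, hk⟩ := exists_parity_ge par i 0
  have hne : {n | ∃ k : ℤ, (k : ZMod 2) = par i ∧ phiAt i k p = n}.Nonempty := ⟨_, k, hk, rfl⟩
  exact ⟨hne.csSup_mem hfin, fun _ h => le_csSup hfin.bddAbove h⟩

/-- The smallest `k` of the same parity as `i` with `ε_i^k(p) = ε_i(p)`; it exists if
`ε_i(p) ≠ 0`. -/
def eIndex (i : I) (p : Monomial I ℤ) : ℤ :=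
  sInf {k : ℤ | (k : ZMod 2) = par i ∧ epsAt i k p = eps par i p}

/-- The largest `k` of the same parity as `i` with `φ_i^k(p) = φ_i(p)`; it exists if
`φ_i(p) ≠ 0`. -/
def fIndex (i : I) (p : Monomial I ℤ) : ℤ :=
  sSup {k : ℤ | (k : ZMod 2) = par i ∧ phiAt i k p = phi par i p}

theorem isLeast_eIndex (i : I) (p : Monomial I ℤ) (h : eps par i p ≠ 0) :
    IsLeast {k : ℤ | (k : ZMod 2) = par i ∧ epsAt i k p = eps par i p} (eIndex par i p) := by
  classical
  have hne : {k : ℤ | (k : ZMod 2) = par i ∧ epsAt i k p = eps par i p}.Nonempty :=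
    (isGreatest_eps par i p).1
  have hbdd : BddBelow {k : ℤ | (k : ZMod 2) = par i ∧ epsAt i k p = eps par i p} := by
    obtain ⟨m, hm⟩ := ((Multiplicative.toAdd p).support.image Prod.snd).bddBelow
    refine ⟨m, fun k hk => ?_⟩
    by_contra hlt
    refine h (hk.2.symm.trans ?_)
    unfold epsAt
    rw [neg_eq_zero]
    refine Finset.sum_eq_zero fun v hv => if_neg fun hv' => hlt ?_
    exact (hm (Finset.mem_coe.2 (Finset.mem_image_of_mem _ hv))).trans hv'.2
  exact ⟨Int.csInf_mem hne hbdd, fun _ hk => csInf_le hbdd hk⟩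

theorem isGreatest_fIndex (i : I) (p : Monomial I ℤ) (h : phi par i p ≠ 0) :
    IsGreatest {k : ℤ | (k : ZMod 2) = par i ∧ phiAt i k p = phi par i p} (fIndex par i p) := by
  classical
  have hne : {k : ℤ | (k : ZMod 2) = par i ∧ phiAt i k p = phi par i p}.Nonempty :=
    (isGreatest_phi par i p).1
  have hbdd : BddAbove {k : ℤ | (k : ZMod 2) = par i ∧ phiAt i k p = phi par i p} := by
    obtain ⟨m, hm⟩ := ((Multiplicative.toAdd p).support.image Prod.snd).bddAbove
    refine ⟨m, fun k hk => ?_⟩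
    by_contra hlt
    refine h (hk.2.symm.trans ?_)
    unfold phiAt
    refine Finset.sum_eq_zero fun v hv => if_neg fun hv' => hlt ?_
    exact hv'.2.trans (hm (Finset.mem_coe.2 (Finset.mem_image_of_mem _ hv)))
  exact ⟨Int.csSup_mem hne hbdd, fun _ hk => le_csSup hbdd hk⟩

end Monomials

section Crystal

variable {ι K M N : Type*} [Field K] [AddCommGroup M] [Module K M]
  [AddCommGroup N] [Module K N] {P : RootPairing ι K M N} (b : P.Base)

/-- The weight `wt(p) = ∑_{i,k} a_{i,k} ϖ_i`. -/
def wt [CharZero K] [P.IsRootSystem] {A : Type*} (p : Monomial b.support A) : coweightLattice P :=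
  (Multiplicative.toAdd p).sum fun v a => a • fundamentalCoweight b v.1

variable [P.IsCrystallographic]

open Classical in
/-- `z_{i,k} = y_{i,k} y_{i,k+2} / ∏_{j ∼ i} y_{j,k+1}`. -/
def z (i : b.support) (k : ℤ) : Monomial b.support ℤ :=
  y i k * y i (k + 2) / ∏ j : b.support with Connected b j i, y j (k + 1)

variable (par : b.support → ZMod 2)

open Classical in
/-- The Kashiwara operator `ẽ_i`, where `none` stands for `0`. -/
def eTilde (i : b.support) (p : Monomial b.support ℤ) : Option (Monomial b.support ℤ) :=
  if eps par i p = 0 then none else some (z b i (eIndex par i p) * p)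

open Classical in
/-- The Kashiwara operator `f̃_i`, where `none` stands for `0`. -/
def fTilde (i : b.support) (p : Monomial b.support ℤ) : Option (Monomial b.support ℤ) :=
  if phi par i p = 0 then none else some ((z b i (fIndex par i p - 2))⁻¹ * p)

/-- The fundamental monomial crystal `𝓑(ϖ_i, c)`, for an integer `c` of the same parity as `i`: the
subcrystal generated by `y_{i,c}`, that is, the smallest set of monomials that contains `y_{i,c}`
and is stable under all `ẽ_j` and `f̃_j`. -/
inductive FundamentalCrystal (i : b.support) (c : ℤ) : Monomial b.support ℤ → Prop
  | gen : FundamentalCrystal i c (y i c)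
  | e (j : b.support) (p q : Monomial b.support ℤ) :
      FundamentalCrystal i c p → eTilde b par j p = some q → FundamentalCrystal i c q
  | f (j : b.support) (p q : Monomial b.support ℤ) :
      FundamentalCrystal i c p → fTilde b par j p = some q → FundamentalCrystal i c q

/-- `𝓑(ϖ_i, c)` consists of monomials in the `y_{j,k}` with `j` and `k` of the same parity. -/
theorem FundamentalCrystal.mem_parityMonomials (hpar : IsBipartition b par) (i : b.support)
    (c : ℤ) (hc : (c : ZMod 2) = par i) (p : Monomial b.support ℤ)
    (hp : FundamentalCrystal b par i c p) : p ∈ parityMonomials par := by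
  classical
  have hy : ∀ (j : b.support) (k : ℤ), (k : ZMod 2) = par j → y j k ∈ parityMonomials par := by
    intro j k hk j' k' h
    by_contra hne
    refine h (Finsupp.single_eq_of_ne fun heq => hne ?_)
    obtain ⟨rfl, rfl⟩ := Prod.mk.inj heq
    exact hk
  have hz : ∀ (j : b.support) (k : ℤ), (k : ZMod 2) = par j → z b j k ∈ parityMonomials par := by
    intro j k hk
    have h2 : ((k + 2 : ℤ) : ZMod 2) = par j := by
      rw [← hk]
      push_cast
      generalize (k : ZMod 2) = x
      revert x
      decide
    refine div_mem (mul_mem (hy j k hk) (hy j _ h2)) (prod_mem fun l hl => hy l _ ?_)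
    have h := hpar j l (Finset.mem_filter.1 hl).2
    rw [← hk] at h
    push_cast
    revert h
    generalize (k : ZMod 2) = x
    generalize par l = x'
    revert x x'
    decide
  induction hp with
  | gen => exact hy i c hc
  | e j p q _ h ih =>
    unfold eTilde at h
    split_ifs at h with h0
    rw [← Option.some.inj h]
    exact mul_mem (hz j _ (isLeast_eIndex par j p h0).1.1) ih
  | f j p q _ h ih =>
    unfold fTilde at h
    split_ifs at h with h0
    rw [← Option.some.inj h]
    refine mul_mem (inv_mem (hz j _ ?_)) ih
    rw [← (isGreatest_fIndex par j p h0).1.1]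
    push_cast
    generalize (fIndex par j p : ZMod 2) = x
    revert x
    decide

/-- `𝓑(ϖ_i, c)` for a complex number `c`: the translate by `c - c₀` of `𝓑(ϖ_i, c₀)`, for `c₀` an
integer of the same parity as `i`. -/
def ComplexFundamentalCrystal (i : b.support) (c : ℂ) (p : Monomial b.support ℂ) : Prop :=
  ∃ c₀ : ℤ, (c₀ : ZMod 2) = par i ∧
    ∃ q : Monomial b.support ℤ, FundamentalCrystal b par i c₀ q ∧ translate (c - c₀) q = p

end Crystal

end MonomialCrystal

end

noncomputable section

namespace MonomialCrystal

open RootPairing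

/-! ### Weyl group action on roots, heights and pairings with coweights. -/

section Roots

variable {ι K M N : Type*} [Field K] [AddCommGroup M] [Module K M]
  [AddCommGroup N] [Module K N] {P : RootPairing ι K M N}

/-! The crystal operators act on the monomials $y_{\gamma,c}$ as simple reflections act on the orbit
$W\varpi_i$. Since $\varpi_i$ is minuscule, $\langle\gamma,\alpha_j\rangle\in\{-1,0,1\}$, and each
node occurs at most once in $y_{\gamma,c}$. Hence $\tilde e_j$ is nonzero exactly when the pairing
is $-1$, and $\tilde f_j$ exactly when it is $1$. The carrying identity is
`extremalMonomial_ofIdx_mul`: if $\langle\gamma,\alpha_j\rangle=1$, then $y_{\gamma,c}$ and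
$y_{s_j\gamma,c}$ differ by the factor $z_{j,k}$ that the operators use. So the crystal is the set
of all $y_{\gamma,c}$, one for each weight in the orbit.

Minimality of $w$ enters through a single consequence, `PreservesLeviPos`: $w$ keeps positive every
positive root orthogonal to $\varpi_i$. It follows from the exchange property, survives the
reflections that move $\gamma$ (`PreservesLeviPos.ofIdx_mul`), and determines the numbers $h(\pm
w^{-1}\alpha_j)$ from $\gamma$ alone (`PreservesLeviPos.hpm_inv_smul_eq`). It also makes
$w^{-1}\alpha_l$ simple whenever $\langle\gamma,\alpha_l\rangle=0$
(`PreservesLeviPos.height_inv_smul_eq_one`), which is what matches the indices at the neighbours of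
$j$. -/

theorem root_weylGroup_smul (w : P.weylGroup) (k : ι) : P.root (w • k) = w • P.root k :=
  Equiv.root_indexEquiv_eq_smul P k (w : P.Aut)

theorem weylGroup_smul_zsmul (w : P.weylGroup) (n : ℤ) (x : M) : w • (n • x) = n • w • x :=
  map_zsmul (DistribSMul.toAddMonoidHom M w) n x

theorem root_weylGroup_smul_of_eq_add (w : P.weylGroup) {k m n : ι} {z : ℤ}
    (h : P.root k = P.root m + z • P.root n) :
    P.root (w • k) = P.root (w • m) + z • P.root (w • n) := by
  simp only [root_weylGroup_smul, h, smul_add, weylGroup_smul_zsmul]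

theorem ofIdx_smul_eq (j k : ι) : weylGroup.ofIdx P j • k = P.reflectionPerm j k := by
  refine P.root.injective ?_
  rw [root_weylGroup_smul, weylGroup.ofIdx_smul, root_reflectionPerm, Equiv.reflection_smul]

theorem ofIdx_inv (j : ι) : (weylGroup.ofIdx P j)⁻¹ = weylGroup.ofIdx P j :=
  Subtype.ext (Equiv.reflection_inv P j)

theorem ofIdx_mul_self (j : ι) : weylGroup.ofIdx P j * weylGroup.ofIdx P j = 1 :=
  inv_eq_iff_mul_eq_one.1 (ofIdx_inv j)

theorem ofIdx_reflectionPerm (j k : ι) : weylGroup.ofIdx P (P.reflectionPerm j k) =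
    weylGroup.ofIdx P j * weylGroup.ofIdx P k * weylGroup.ofIdx P j := by
  refine Subtype.ext (Equiv.weightHom_injective P (LinearEquiv.ext fun x => ?_))
  change P.reflection (P.reflectionPerm j k) x =
    P.reflection j (P.reflection k (P.reflection j x))
  rw [reflection_reflectionPerm]
  rfl

theorem mem_of_forall_ofIdx_mem (S : Submonoid P.weylGroup)
    (hS : ∀ j, weylGroup.ofIdx P j ∈ S) (w : P.weylGroup) : w ∈ S := by
  obtain ⟨w, hw⟩ := w
  exact weylGroup.induction P (pred := fun g hg => (⟨g, hg⟩ : P.weylGroup) ∈ S) hS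
    (one_mem S) (fun x y hx hy h1 h2 => mul_mem h1 h2) hw

/-- The elements $w$ that satisfy this for all $k$ form a submonoid, and it contains every
reflection. -/
theorem ofIdx_weylGroup_smul (w : P.weylGroup) (k : ι) :
    weylGroup.ofIdx P (w • k) = w * weylGroup.ofIdx P k * w⁻¹ :=
  mem_of_forall_ofIdx_mem
    { carrier := {w | ∀ k, weylGroup.ofIdx P (w • k) = w * weylGroup.ofIdx P k * w⁻¹}
      one_mem' := fun k => by rw [one_smul, one_mul, inv_one, mul_one]
      mul_mem' := fun {v w} hv hw k => by
        rw [mul_smul, hv, hw, mul_inv_rev]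
        simp only [mul_assoc] }
    (fun j k => by rw [ofIdx_smul_eq, ofIdx_reflectionPerm, ofIdx_inv]) w k

theorem root_reflectionPerm_self' (k : ι) : P.root (P.reflectionPerm k k) = -P.root k := by
  simp

variable [CharZero K]

omit [CharZero K] in
theorem root_reflectionPerm_pairingIn [P.IsCrystallographic] (j k : ι) :
    P.root (P.reflectionPerm j k) = P.root k + (-P.pairingIn ℤ k j) • P.root j := by
  rw [root_reflectionPerm, neg_smul, reflection_apply_root' ℤ, sub_eq_add_neg]

theorem pairing_of_root_eq_add (x : coweightLattice P) {k m n : ι} {z : ℤ}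
    (h : P.root k = P.root m + z • P.root n) :
    pairing x k = pairing x m + z * pairing x n := by
  have : (pairing x k : K) = ((pairing x m + z * pairing x n : ℤ) : K) := by
    push_cast
    simp only [← pairing_spec, h, map_add, map_zsmul, LinearMap.add_apply, LinearMap.smul_apply,
      zsmul_eq_mul]
  exact_mod_cast this

theorem pairing_of_root_eq_neg (x : coweightLattice P) {k m : ι} (h : P.root k = -P.root m) :
    pairing x k = -pairing x m := by
  -- The constant comes from $-\alpha=\alpha+(-2)\alpha$.
  have := pairing_of_root_eq_add x (k := k) (m := m) (n := m) (z := -2) (by rw [h]; module)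
  lia

theorem pairing_of_root_eq_sum (x : coweightLattice P) {k : ι} {s : Finset ι} {f : ι → ℤ}
    (h : P.root k = ∑ j ∈ s, f j • P.root j) : pairing x k = ∑ j ∈ s, f j * pairing x j := by
  have : (pairing x k : K) = ((∑ j ∈ s, f j * pairing x j : ℤ) : K) := by
    push_cast
    simp only [← pairing_spec, h, map_sum, map_zsmul, LinearMap.sum_apply, LinearMap.smul_apply,
      zsmul_eq_mul]
  exact_mod_cast this

/-- Pairing with a fixed root, as an additive map on the coweight lattice. -/
def pairingHom (k : ι) : coweightLattice P →+ ℤ where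
  toFun x := pairing x k
  map_zero' := by
    have : (pairing (0 : coweightLattice P) k : K) = 0 := by
      rw [← pairing_spec]; simp
    exact_mod_cast this
  map_add' x x' := by
    have : (pairing (x + x') k : K) = pairing x k + pairing x' k := by
      simp only [← pairing_spec]; simp
    exact_mod_cast this

theorem pairingHom_apply (k : ι) (x : coweightLattice P) : pairingHom k x = pairing x k := rfl

variable (b : P.Base)

theorem height_of_root_eq_neg {k m : ι} (h : P.root k = -P.root m) :
    b.height k = -b.height m := by
  have := b.height_add_zsmul (k := k) (i := m) (j := m) (z := -2) (by rw [h]; module)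
  rw [this, smul_eq_mul]
  ring

theorem isPos_reflectionPerm_self {k : ι} (h : ¬ b.IsPos k) : b.IsPos (P.reflectionPerm k k) := by
  rw [Base.isPos_iff'] at h ⊢
  rw [height_of_root_eq_neg b (root_reflectionPerm_self' k)]
  lia

theorem exists_nonneg_of_isPos {k : ι} (h : b.IsPos k) :
    ∃ f : ι → ℤ, (∀ j, 0 ≤ f j) ∧ P.root k = ∑ j ∈ b.support, f j • P.root j := by
  obtain ⟨f, -, hf | hf, hk⟩ := b.exists_root_eq_sum_int k
  · exact ⟨f, fun j => hf.le j, hk⟩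
  · rw [Base.isPos_iff, Base.height_eq_sum hk] at h
    exact absurd (Finset.sum_nonpos fun j _ => hf.le j) (not_le.2 h)

section RootSystem

variable [P.IsRootSystem]

omit [CharZero K] in
theorem coweight_ext {x x' : coweightLattice P}
    (h : ∀ j : b.support, pairing x j = pairing x' j) : x = x' := by
  refine Subtype.ext (P.flip.toPerfPair.injective (b.toWeightBasis.ext fun j => ?_))
  rw [Base.toWeightBasis_apply]
  change P.toLinearMap (P.root j) (x : N) = P.toLinearMap (P.root j) (x' : N)
  rw [pairing_spec, pairing_spec, h]

theorem pairing_rhoCheck_of_mem_support (j : b.support) : pairing (rhoCheck b) j = 1 := by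
  classical
  rw [← pairingHom_apply, rhoCheck, map_sum]
  simp [pairingHom_apply, pairing_fundamentalCoweight]

theorem pairing_rhoCheck (k : ι) : pairing (rhoCheck b) k = b.height k := by
  obtain ⟨f, -, -, hf⟩ := b.exists_root_eq_sum_int k
  rw [Base.height_eq_sum hf, pairing_of_root_eq_sum _ hf]
  refine Finset.sum_congr rfl fun j hj => ?_
  rw [pairing_rhoCheck_of_mem_support b ⟨j, hj⟩, mul_one]

/-- Removes the case distinction on signs, so that additivity of the height can be used. -/
theorem hpm_eq_abs_height (k : ι) : hpm b k = |b.height k| := by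
  unfold hpm
  rw [pairing_rhoCheck, pairing_rhoCheck, height_of_root_eq_neg b (root_reflectionPerm_self' k)]
  split_ifs with h
  · exact (abs_of_pos h).symm
  · rw [Base.isPos_iff, not_lt] at h
    exact (abs_of_nonpos h).symm

theorem pairing_fundamentalCoweight_nonneg (i : b.support) {k : ι} (h : b.IsPos k) :
    0 ≤ pairing (fundamentalCoweight b i) k := by
  classical
  obtain ⟨f, hf0, hf⟩ := exists_nonneg_of_isPos b h
  rw [pairing_of_root_eq_sum _ hf]
  refine Finset.sum_nonneg fun j hj => mul_nonneg (hf0 j) ?_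
  rw [pairing_fundamentalCoweight b i ⟨j, hj⟩]
  split_ifs <;> simp

theorem isPos_of_pairing_fundamentalCoweight_pos (i : b.support) {k : ι}
    (h : 0 < pairing (fundamentalCoweight b i) k) : b.IsPos k := by
  by_contra hk
  have := pairing_fundamentalCoweight_nonneg b i (isPos_reflectionPerm_self b hk)
  rw [pairing_of_root_eq_neg _ (root_reflectionPerm_self' k)] at this
  lia

end RootSystem

variable [Finite ι] [P.IsCrystallographic]

/-- A positive root pairs positively with some simple root; if the two differ, their difference is
again a root, and it is positive. -/
theorem exists_root_eq_add_of_height_ne_one {k : ι} (h : b.IsPos k) (h1 : b.height k ≠ 1) :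
    ∃ m n, b.IsPos m ∧ b.IsPos n ∧ P.root k = P.root m + (1 : ℤ) • P.root n := by
  obtain ⟨j, hj, hj'⟩ := h.exists_mem_support_pos_pairingIn
  rw [P.zero_lt_pairingIn_iff'] at hj'
  have hne : k ≠ j := by
    rintro rfl
    exact h1 (Base.height_one_of_mem_support hj)
  obtain ⟨m, hm⟩ := P.root_sub_root_mem_of_pairingIn_pos hj' hne
  exact ⟨m, j, h.sub hj hm, b.isPos_of_mem_support hj, by rw [hm]; module⟩

/-- A Weyl group element that preserves positivity preserves heights. -/
theorem height_smul_of_preserves_isPos (w : P.weylGroup)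
    (hw : ∀ k, b.IsPos k → b.IsPos (w • k)) (k : ι) : b.height (w • k) = b.height k := by
  have hneg : ∀ k, P.root (w • P.reflectionPerm k k) = -P.root (w • k) := fun k => by
    rw [root_weylGroup_smul, root_weylGroup_smul, root_reflectionPerm_self', smul_neg]
  have hinv : ∀ k, b.IsPos k → b.IsPos (w⁻¹ • k) := by
    intro k hk
    by_contra h
    have h' := hw _ (isPos_reflectionPerm_self b h)
    have h2 := hneg (w⁻¹ • k)
    rw [smul_inv_smul] at h2
    rw [Base.isPos_iff, height_of_root_eq_neg b h2] at h'
    rw [Base.isPos_iff] at hk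
    lia
  -- If the image of a simple root were a sum of two positive roots, applying `w⁻¹`, which also
  -- preserves positivity, would give the simple root height at least two.
  have hsimple : ∀ k ∈ b.support, b.height (w • k) = 1 := by
    intro k hk
    by_contra h
    obtain ⟨m, n, hm, hn, hmn⟩ :=
      exists_root_eq_add_of_height_ne_one b (hw k (b.isPos_of_mem_support hk)) h
    have h3 := b.height_add_zsmul (root_weylGroup_smul_of_eq_add w⁻¹ hmn)
    rw [inv_smul_smul, Base.height_one_of_mem_support hk, one_smul] at h3
    have h4 := hinv m hm
    have h5 := hinv n hn
    rw [Base.isPos_iff] at h4 h5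
    lia
  have hpos : ∀ k, b.IsPos k → b.height (w • k) = b.height k := by
    intro k hk
    refine hk.induction_on_add (p := fun k => b.height (w • k) = b.height k)
      (fun j hj => by rw [hsimple j hj, Base.height_one_of_mem_support hj]) ?_
    intro m j k hk hm hj
    have hk' : P.root k = P.root m + (1 : ℤ) • P.root j := by rw [hk, one_smul]
    rw [b.height_add_zsmul hk', b.height_add_zsmul (root_weylGroup_smul_of_eq_add w hk'), hm,
      hsimple j hj, Base.height_one_of_mem_support hj]
  by_cases hk : b.IsPos k
  · exact hpos k hk
  · have h := hpos _ (isPos_reflectionPerm_self b hk)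
    rw [height_of_root_eq_neg b (hneg k), height_of_root_eq_neg b (root_reflectionPerm_self' k)] at h
    lia

end Roots

end MonomialCrystal
end

noncomputable section

namespace MonomialCrystal

open RootPairing

/-! ### Minimal coset representatives and the exchange property. -/

section MinimalRepresentatives

variable {ι K M N : Type*} [Field K] [AddCommGroup M] [Module K M]
  [AddCommGroup N] [Module K N] {P : RootPairing ι K M N} (b : P.Base)

/-- The product of a word in the simple reflections. -/
def wordProd (l : List b.support) : P.weylGroup :=
  (l.map fun j : b.support => weylGroup.ofIdx P (j : ι)).prod

theorem wordProd_cons (j : b.support) (l : List b.support) :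
    wordProd b (j :: l) = weylGroup.ofIdx P (j : ι) * wordProd b l := by
  rw [wordProd, wordProd, List.map_cons, List.prod_cons]

theorem length_eq_sInf (w : P.weylGroup) :
    length b w = sInf {n | ∃ l : List b.support, l.length = n ∧ wordProd b l = w} := by
  simp [length, wordProd]

theorem length_wordProd_le (l : List b.support) : length b (wordProd b l) ≤ l.length := by
  rw [length_eq_sInf]
  exact Nat.sInf_le ⟨l, rfl, rfl⟩

/-- The length is attained by a word. -/
theorem exists_word_length_eq [CharZero K] [Finite ι] [P.IsCrystallographic] [P.IsReduced]
    (w : P.weylGroup) : ∃ l : List b.support, l.length = length b w ∧ wordProd b l = w := by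
  obtain ⟨l, hl⟩ := exists_word b w
  rw [length_eq_sInf]
  exact Nat.sInf_mem (s := {n | ∃ l : List b.support, l.length = n ∧ wordProd b l = w})
    ⟨_, l, rfl, by simpa [wordProd, Function.comp_def] using hl⟩

variable [CharZero K]

theorem isPos_smul_reflectionPerm_self_iff (w : P.weylGroup) (k : ι) :
    b.IsPos (w • P.reflectionPerm k k) ↔ ¬ b.IsPos (w • k) := by
  have h : P.root (w • P.reflectionPerm k k) = -P.root (w • k) := by
    rw [root_weylGroup_smul, root_weylGroup_smul, root_reflectionPerm_self', smul_neg]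
  rw [Base.isPos_iff, Base.isPos_iff, height_of_root_eq_neg b h]
  have := b.height_ne_zero (w • k)
  lia

section Coweight

variable [P.IsRootSystem]

theorem weylGroup_mul_smul_coweight (b : P.Base) (v w : P.weylGroup) (x : coweightLattice P) :
    (v * w) • x = v • w • x := by
  refine coweight_ext b fun j => ?_
  rw [pairing_smul, pairing_smul, pairing_smul, mul_inv_rev, mul_smul]

theorem weylGroup_one_smul_coweight (b : P.Base) (x : coweightLattice P) : (1 : P.weylGroup) • x = x := by
  refine coweight_ext b fun j => ?_
  rw [pairing_smul, inv_one, one_smul]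

end Coweight

variable [Finite ι] [P.IsCrystallographic]

omit [Finite ι] in
theorem pairing_ofIdx_smul (j k : ι) (x : coweightLattice P) :
    pairing (weylGroup.ofIdx P j • x) k = pairing x k - P.pairingIn ℤ k j * pairing x j := by
  rw [pairing_smul, ofIdx_inv, ofIdx_smul_eq,
    pairing_of_root_eq_add x (root_reflectionPerm_pairingIn j k)]
  ring

omit [Finite ι] in
theorem ofIdx_smul_eq_self_of_pairing_eq_zero (b : P.Base) [P.IsRootSystem] (j : ι) (x : coweightLattice P)
    (h : pairing x j = 0) : weylGroup.ofIdx P j • x = x := by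
  refine coweight_ext b fun k => ?_
  rw [pairing_ofIdx_smul, h, mul_zero, sub_zero]

variable [P.IsReduced]

theorem isPos_ofIdx_smul (j : b.support) {k : ι} (hk : b.IsPos k) (hjk : k ≠ j) :
    b.IsPos (weylGroup.ofIdx P (j : ι) • k) := by
  rw [ofIdx_smul_eq]
  exact hk.reflectionPerm j.2 hjk

/-- The exchange property. -/
theorem exists_shorter_word (k : ι) (hk : b.IsPos k) (l : List b.support)
    (h : ¬ b.IsPos (wordProd b l • k)) :
    ∃ l' : List b.support, l'.length < l.length ∧
      wordProd b l' =
        wordProd b l * weylGroup.ofIdx P k := by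
  induction l with
  | nil => simp [wordProd, hk] at h
  | cons a l ih =>
    rw [wordProd_cons, mul_smul] at h
    -- If the tail keeps the root positive, the letter `a` is what makes it negative, so the tail
    -- sends it to the simple root of `a`. Conjugation then shows that right multiplication by the
    -- reflection deletes `a`.
    by_cases hl : b.IsPos (wordProd b l • k)
    · refine ⟨l, by simp, ?_⟩
      have ha : wordProd b l • k = (a : ι) := by
        by_contra hne
        exact h (isPos_ofIdx_smul b a hl hne)
      have h2 := ofIdx_weylGroup_smul (wordProd b l) k
      rw [ha] at h2
      rw [wordProd_cons, h2, inv_mul_cancel_right, mul_assoc, ofIdx_mul_self,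
        mul_one]
    · obtain ⟨l', hl', h'⟩ := ih hl
      exact ⟨a :: l', by simpa using hl', by rw [wordProd_cons, wordProd_cons, h', mul_assoc]⟩

theorem length_mul_ofIdx_lt (w : P.weylGroup) {k : ι} (hk : b.IsPos k)
    (h : ¬ b.IsPos (w • k)) : length b (w * weylGroup.ofIdx P k) < length b w := by
  obtain ⟨l, hl, rfl⟩ := exists_word_length_eq b w
  obtain ⟨l', hl', h'⟩ := exists_shorter_word b k hk l h
  rw [← hl, ← h']
  exact lt_of_le_of_lt (length_wordProd_le b l') hl'

variable [P.IsRootSystem]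

/-- `w` sends the positive roots orthogonal to `ϖ_i` to positive roots. -/
def PreservesLeviPos (i : b.support) (w : P.weylGroup) : Prop :=
  ∀ k, b.IsPos k → pairing (fundamentalCoweight b i) k = 0 → b.IsPos (w • k)

variable {b} {i : b.support}

/-- If such a root $\beta$ became negative, $ws_\beta$ would be shorter, with the same value on
$\varpi_i$ because $s_\beta$ fixes it. -/
theorem IsMinimalTaking.preservesLeviPos {w : P.weylGroup} {γ : coweightLattice P}
    (hw : IsMinimalTaking b w (fundamentalCoweight b i) γ) : PreservesLeviPos b i w := by
  intro k hk hk0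
  by_contra h
  refine not_lt.2 (hw.2 (w * weylGroup.ofIdx P k) ?_) (length_mul_ofIdx_lt b w hk h)
  rw [weylGroup_mul_smul_coweight b, ofIdx_smul_eq_self_of_pairing_eq_zero b _ _ hk0, hw.1]

omit [Finite ι] [P.IsCrystallographic] [P.IsReduced] in
theorem preservesLeviPos_one : PreservesLeviPos b i 1 := fun k hk _ => by rwa [one_smul]

/-- Among positive roots $s_j$ makes only $\alpha_j$ negative, and $w^{-1}\alpha_j$ is not
orthogonal to $\varpi_i$. -/
theorem PreservesLeviPos.ofIdx_mul {w : P.weylGroup} (hw : PreservesLeviPos b i w) (j : b.support)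
    (hj : pairing (w • fundamentalCoweight b i) j ≠ 0) :
    PreservesLeviPos b i (weylGroup.ofIdx P (j : ι) * w) := by
  intro k hk hk0
  rw [mul_smul]
  refine isPos_ofIdx_smul b j (hw k hk hk0) fun h => hj ?_
  rw [pairing_smul, ← h, inv_smul_smul, hk0]

-- The root $w^{-1}\alpha_j$ is orthogonal to $\varpi_i$, hence positive. If it split into two
-- positive roots, both would be orthogonal to $\varpi_i$, since their pairings are nonnegative with
-- sum zero. Then $w$ would write $\alpha_j$ as a sum of two positive roots.
omit [P.IsReduced] in
theorem PreservesLeviPos.height_inv_smul_eq_one {w : P.weylGroup} (hw : PreservesLeviPos b i w)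
    (j : b.support) (hj : pairing (w • fundamentalCoweight b i) j = 0) :
    b.height (w⁻¹ • (j : ι)) = 1 := by
  rw [pairing_smul] at hj
  have hj1 : b.height (j : ι) = 1 := Base.height_one_of_mem_support j.2
  have hpos : b.IsPos (w⁻¹ • (j : ι)) := by
    by_contra h
    have h2 := hw _ (isPos_reflectionPerm_self b h) (by
      rw [pairing_of_root_eq_neg _ (root_reflectionPerm_self' _), hj, neg_zero])
    rw [isPos_smul_reflectionPerm_self_iff, smul_inv_smul] at h2
    exact h2 (b.isPos_of_mem_support j.2)
  by_contra h
  obtain ⟨m, n, hm, hn, hmn⟩ := exists_root_eq_add_of_height_ne_one b hpos h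
  have hp := pairing_of_root_eq_add (fundamentalCoweight b i) hmn
  have hm0 := pairing_fundamentalCoweight_nonneg b i hm
  have hn0 := pairing_fundamentalCoweight_nonneg b i hn
  have hm1 := hw m hm (by lia)
  have hn1 := hw n hn (by lia)
  have hh := b.height_add_zsmul (root_weylGroup_smul_of_eq_add w hmn)
  rw [smul_inv_smul, hj1, one_smul] at hh
  rw [Base.isPos_iff] at hm1 hn1
  lia

-- The element $u=v^{-1}w$ fixes $\varpi_i$ and preserves all positive roots, hence all heights.
-- Roots with positive pairing stay positive because the pairing is unchanged; for orthogonal ones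
-- the two hypotheses are compared.
omit [P.IsReduced] in
theorem PreservesLeviPos.hpm_inv_smul_eq {v w : P.weylGroup} (hv : PreservesLeviPos b i v)
    (hw : PreservesLeviPos b i w)
    (h : v • fundamentalCoweight b i = w • fundamentalCoweight b i) (k : ι) :
    hpm b (v⁻¹ • k) = hpm b (w⁻¹ • k) := by
  have hu : ∀ k, b.IsPos k → b.IsPos ((v⁻¹ * w) • k) := by
    intro k hk
    have hfix : pairing (fundamentalCoweight b i) ((v⁻¹ * w) • k) =
        pairing (fundamentalCoweight b i) k := by
      rw [mul_smul, ← pairing_smul, h, pairing_smul, inv_smul_smul]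
    have h0 := pairing_fundamentalCoweight_nonneg b i hk
    rcases h0.lt_or_eq with h0 | h0
    · exact isPos_of_pairing_fundamentalCoweight_pos b i (by rwa [hfix])
    · by_contra hneg
      have h2 := hv _ (isPos_reflectionPerm_self b hneg) (by
        rw [pairing_of_root_eq_neg _ (root_reflectionPerm_self' _), hfix, ← h0, neg_zero])
      rw [isPos_smul_reflectionPerm_self_iff, smul_smul, mul_inv_cancel_left] at h2
      exact h2 (hw k hk h0.symm)
  have := height_smul_of_preserves_isPos b (v⁻¹ * w) hu (w⁻¹ • k)
  rw [smul_smul, mul_inv_cancel_right] at this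
  rw [hpm_eq_abs_height, hpm_eq_abs_height, this]

end MinimalRepresentatives

end MonomialCrystal
end

noncomputable section

namespace MonomialCrystal

open RootPairing

/-! ### Monomials with one factor per node, and their string data. -/

section SparseMonomials

variable {I A : Type*} [Fintype I]

/-- The monomial `∏_j y_{j,s_j}^{a_j}`. -/
def sparseMonomial (a : I → ℤ) (s : I → A) : Monomial I A := ∏ j, y j (s j) ^ a j

theorem toAdd_sparseMonomial (a : I → ℤ) (s : I → A) :
    Multiplicative.toAdd (sparseMonomial a s) = ∑ j, Finsupp.single (j, s j) (a j) := by
  rw [sparseMonomial, toAdd_prod]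
  refine Finset.sum_congr rfl fun j _ => ?_
  rw [toAdd_zpow, y, toAdd_ofAdd, Finsupp.smul_single, smul_eq_mul, mul_one]

theorem sum_sparseMonomial {G : Type*} [AddCommGroup G] (a : I → ℤ) (s : I → A)
    (g : I × A → ℤ → G) (h0 : ∀ v, g v 0 = 0) (hadd : ∀ v m n, g v (m + n) = g v m + g v n) :
    (Multiplicative.toAdd (sparseMonomial a s)).sum g = ∑ j, g (j, s j) (a j) := by
  rw [toAdd_sparseMonomial, ← Finsupp.sum_finsetSum_index h0 hadd]
  exact Finset.sum_congr rfl fun j _ => (Finsupp.sum_single_index (h0 _))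

theorem expo_sparseMonomial (a : I → ℤ) (s : I → A) (i : I) :
    expo (sparseMonomial a s) i (s i) = a i := by
  classical
  rw [expo, toAdd_sparseMonomial, Finsupp.finsetSum_apply, Finset.sum_eq_single i]
  · simp
  · intro j _ hj
    exact Finsupp.single_eq_of_ne fun h => hj (Prod.mk.inj h).1.symm
  · simp

theorem epsAt_sparseMonomial (a : I → ℤ) (s : I → ℤ) (i : I) (k : ℤ) :
    epsAt i k (sparseMonomial a s) = if s i ≤ k then -a i else 0 := by
  classical
  rw [epsAt, sum_sparseMonomial, Finset.sum_eq_single i]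
  · by_cases h : s i ≤ k <;> simp [h]
  · intro j _ hj
    simp [hj]
  · simp
  · simp
  · intro v m n
    split_ifs <;> simp

theorem phiAt_sparseMonomial (a : I → ℤ) (s : I → ℤ) (i : I) (k : ℤ) :
    phiAt i k (sparseMonomial a s) = if k ≤ s i then a i else 0 := by
  classical
  rw [phiAt, sum_sparseMonomial, Finset.sum_eq_single i]
  · by_cases h : k ≤ s i <;> simp [h]
  · intro j _ hj
    simp [hj]
  · simp
  · simp
  · intro v m n
    split_ifs <;> simp

variable (par : I → ZMod 2) {a : I → ℤ} {s : I → ℤ}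

theorem eps_sparseMonomial {i : I} (hs : (s i : ZMod 2) = par i) :
    eps par i (sparseMonomial a s) = max (-a i) 0 := by
  refine (isGreatest_eps par i _).unique ⟨?_, ?_⟩
  · rcases le_total 0 (-a i) with h | h
    · exact ⟨s i, hs, by rw [epsAt_sparseMonomial, if_pos le_rfl, max_eq_left h]⟩
    -- Strictly to the left of the only factor at `i` the partial sum is empty, so the value zero is
    -- attained.
    · obtain ⟨k, hk, hk'⟩ := exists_parity_le par i (s i - 1)
      exact ⟨k, hk', by rw [epsAt_sparseMonomial, if_neg (by lia), max_eq_right h]⟩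
  · rintro _ ⟨k, -, rfl⟩
    rw [epsAt_sparseMonomial]
    split_ifs <;> simp

theorem phi_sparseMonomial {i : I} (hs : (s i : ZMod 2) = par i) :
    phi par i (sparseMonomial a s) = max (a i) 0 := by
  refine (isGreatest_phi par i _).unique ⟨?_, ?_⟩
  · rcases le_total 0 (a i) with h | h
    · exact ⟨s i, hs, by rw [phiAt_sparseMonomial, if_pos le_rfl, max_eq_left h]⟩
    · obtain ⟨k, hk, hk'⟩ := exists_parity_ge par i (s i + 1)
      exact ⟨k, hk', by rw [phiAt_sparseMonomial, if_neg (by lia), max_eq_right h]⟩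
  · rintro _ ⟨k, -, rfl⟩
    rw [phiAt_sparseMonomial]
    split_ifs <;> simp

theorem eIndex_sparseMonomial {i : I} (hs : (s i : ZMod 2) = par i) (ha : a i < 0) :
    eIndex par i (sparseMonomial a s) = s i := by
  have he := eps_sparseMonomial (a := a) par hs
  have h := isLeast_eIndex par i (sparseMonomial a s) (by lia)
  refine h.unique ⟨⟨hs, ?_⟩, ?_⟩
  · rw [he, epsAt_sparseMonomial, if_pos le_rfl]
    lia
  · rintro k ⟨-, hk⟩
    rw [he, epsAt_sparseMonomial] at hk
    by_contra hlt
    rw [if_neg hlt] at hk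
    lia

theorem fIndex_sparseMonomial {i : I} (hs : (s i : ZMod 2) = par i) (ha : 0 < a i) :
    fIndex par i (sparseMonomial a s) = s i := by
  have he := phi_sparseMonomial (a := a) par hs
  have h := isGreatest_fIndex par i (sparseMonomial a s) (by lia)
  refine h.unique ⟨⟨hs, ?_⟩, ?_⟩
  · rw [he, phiAt_sparseMonomial, if_pos le_rfl]
    lia
  · rintro k ⟨-, hk⟩
    rw [he, phiAt_sparseMonomial] at hk
    by_contra hlt
    rw [if_neg hlt] at hk
    lia

/-- No parity of `s i` is needed here. This matters because a node with exponent zero has an index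
of uncontrolled parity. -/
theorem eps_sparseMonomial_eq_zero {i : I} (ha : 0 ≤ a i) :
    eps par i (sparseMonomial a s) = 0 := by
  refine (isGreatest_eps par i _).unique ⟨?_, ?_⟩
  · obtain ⟨k, hk, hk'⟩ := exists_parity_le par i (s i - 1)
    exact ⟨k, hk', by rw [epsAt_sparseMonomial, if_neg (by lia)]⟩
  · rintro _ ⟨k, -, rfl⟩
    rw [epsAt_sparseMonomial]
    split_ifs <;> simp [ha]

theorem phi_sparseMonomial_eq_zero {i : I} (ha : a i ≤ 0) :
    phi par i (sparseMonomial a s) = 0 := by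
  refine (isGreatest_phi par i _).unique ⟨?_, ?_⟩
  · obtain ⟨k, hk, hk'⟩ := exists_parity_ge par i (s i + 1)
    exact ⟨k, hk', by rw [phiAt_sparseMonomial, if_neg (by lia)]⟩
  · rintro _ ⟨k, -, rfl⟩
    rw [phiAt_sparseMonomial]
    split_ifs <;> simp [ha]

end SparseMonomials

/-! ### The monomials $y_{\gamma,c}$ and their behaviour under simple reflections. -/

section Extremal

variable {ι K M N : Type*} [Field K] [CharZero K] [AddCommGroup M] [Module K M]
  [AddCommGroup N] [Module K N] {P : RootPairing ι K M N} [P.IsRootSystem] (b : P.Base)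

theorem wt_sparseMonomial {A : Type*} (a : b.support → ℤ) (s : b.support → A) :
    wt b (sparseMonomial a s) = ∑ j, a j • fundamentalCoweight b j :=
  sum_sparseMonomial a s (fun v a => a • fundamentalCoweight b v.1) (fun _ => zero_smul _ _)
    fun _ _ _ => add_smul _ _ _

theorem sum_pairing_smul_fundamentalCoweight (x : coweightLattice P) :
    ∑ j : b.support, pairing x j • fundamentalCoweight b j = x := by
  classical
  refine coweight_ext b fun k => ?_
  rw [← pairingHom_apply, map_sum]
  simp_rw [map_zsmul, pairingHom_apply, pairing_fundamentalCoweight]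
  simp

theorem toAdd_translate {I : Type*} (d : ℂ) (p : Monomial I ℤ) :
    Multiplicative.toAdd (translate d p) =
      Finsupp.mapDomain (fun v : I × ℤ => (v.1, (v.2 : ℂ) + d)) (Multiplicative.toAdd p) := rfl

theorem translate_y {I : Type*} (d : ℂ) (i : I) (k : ℤ) : translate d (y i k) = y i (k + d) :=
  Multiplicative.toAdd.injective <| by
    rw [toAdd_translate, y, y, toAdd_ofAdd, toAdd_ofAdd, Finsupp.mapDomain_single]

theorem wt_translate (d : ℂ) (p : Monomial b.support ℤ) : wt b (translate d p) = wt b p := by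
  rw [wt, toAdd_translate, Finsupp.sum_mapDomain_index, wt]
  · exact fun _ => zero_smul _ _
  · exact fun _ _ _ => add_smul _ _ _

/-- The monomial `y_{γ,c}` for `γ = w ϖ_i`, computed from `w`. -/
def extremalMonomial (i : b.support) (c : ℤ) (w : P.weylGroup) : Monomial b.support ℤ :=
  sparseMonomial (fun j => pairing (w • fundamentalCoweight b i) j)
    fun j => c - hpm b (w⁻¹ • (j : ι)) + pairing (w • fundamentalCoweight b i) j

theorem wt_extremalMonomial (i : b.support) (c : ℤ) (w : P.weylGroup) :
    wt b (extremalMonomial b i c w) = w • fundamentalCoweight b i := by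
  rw [extremalMonomial, wt_sparseMonomial, sum_pairing_smul_fundamentalCoweight]

/-- Only node `i` has a nonzero exponent, and its shift $-h(\alpha_i)+1$ vanishes because $\alpha_i$
has height one. -/
theorem extremalMonomial_one (i : b.support) (c : ℤ) : extremalMonomial b i c 1 = y i c := by
  classical
  rw [extremalMonomial, sparseMonomial, Finset.prod_eq_single i]
  · rw [weylGroup_one_smul_coweight b, pairing_fundamentalCoweight, if_pos rfl, inv_one, one_smul,
      hpm_eq_abs_height, Base.height_one_of_mem_support i.2]
    simp
  · intro j _ hj
    rw [weylGroup_one_smul_coweight b, pairing_fundamentalCoweight, if_neg hj.symm, zpow_zero]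
  · simp

variable {b}

theorem IsMinuscule.pairing_smul {i : b.support} (hi : IsMinuscule b i) (w : P.weylGroup) (k : ι) :
    pairing (w • fundamentalCoweight b i) k = -1 ∨
      pairing (w • fundamentalCoweight b i) k = 0 ∨
      pairing (w • fundamentalCoweight b i) k = 1 := by
  rw [MonomialCrystal.pairing_smul]
  exact hi _

variable [Finite ι] [P.IsCrystallographic]

theorem extremalMonomial_congr {i : b.support} (c : ℤ) {v w : P.weylGroup}
    (hv : PreservesLeviPos b i v) (hw : PreservesLeviPos b i w)
    (h : v • fundamentalCoweight b i = w • fundamentalCoweight b i) :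
    extremalMonomial b i c v = extremalMonomial b i c w := by
  simp only [extremalMonomial, h, hv.hpm_inv_smul_eq hw h]

-- Written as a product over all nodes, so that identities of monomials can be checked node by node.
omit [CharZero K] [P.IsRootSystem] [Finite ι] in
theorem z_eq_prod [DecidableEq b.support] (j : b.support) (k : ℤ) :
    z b j k = ∏ l : b.support, if l = j then y l k * y l (k + 2) else
      if b.cartanMatrix l j ≠ 0 then (y l (k + 1))⁻¹ else 1 := by
  classical
  rw [← Finset.mul_prod_erase _ _ (Finset.mem_univ j), if_pos rfl, z, div_eq_mul_inv,
    Finset.prod_filter, ← Finset.prod_inv_distrib,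
    ← Finset.mul_prod_erase Finset.univ
      (fun l => (if Connected b l j then y l (k + 1) else 1)⁻¹) (Finset.mem_univ j), if_neg (fun h => h.1 rfl), inv_one, one_mul]
  congr 1
  refine Finset.prod_congr rfl fun l hl => ?_
  have hlj := Finset.ne_of_mem_erase hl
  rw [if_neg hlj]
  by_cases h : b.cartanMatrix l j = 0 <;> simp [Connected, hlj, h]

variable [P.IsReduced]

/-- Let $h$ be the height of $w^{-1}\alpha_j$, which is positive. At node $j$ the factor $z$ turns
$y_{j,c-h-1}^{-1}$ into $y_{j,c-h+1}$. At a neighbour $l$ it contributes $y_{l,c-h}^{-1}$, so what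
has to be shown is that the factor at $l$ sits at index $c-h$ on the side where it occurs. Other
nodes are unaffected. -/
theorem extremalMonomial_ofIdx_mul (hsl : b.cartanMatrix.IsSimplyLaced) {i : b.support}
    (hi : IsMinuscule b i) (c : ℤ) {w : P.weylGroup} (hw : PreservesLeviPos b i w) (j : b.support)
    (hj : pairing (w • fundamentalCoweight b i) j = 1) :
    z b j (c - hpm b (w⁻¹ • (j : ι)) - 1) *
      extremalMonomial b i c (weylGroup.ofIdx P (j : ι) * w) = extremalMonomial b i c w := by
  classical
  have hw' := hw.ofIdx_mul j (by lia)
  have hpos : b.IsPos (w⁻¹ • (j : ι)) := by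
    refine isPos_of_pairing_fundamentalCoweight_pos b i ?_
    rw [← pairing_smul, hj]
    exact one_pos
  have hpair : ∀ k : ι, pairing ((weylGroup.ofIdx P (j : ι) * w) • fundamentalCoweight b i) k =
      pairing (w • fundamentalCoweight b i) k - P.pairingIn ℤ k j := fun k => by
    rw [weylGroup_mul_smul_coweight b, pairing_ofIdx_smul, hj, mul_one]
  have hheight : ∀ k : ι, b.height ((weylGroup.ofIdx P (j : ι) * w)⁻¹ • k) =
      b.height (w⁻¹ • k) - P.pairingIn ℤ k j * b.height (w⁻¹ • (j : ι)) := fun k => by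
    rw [mul_inv_rev, ofIdx_inv, mul_smul, ofIdx_smul_eq,
      b.height_add_zsmul (root_weylGroup_smul_of_eq_add w⁻¹ (root_reflectionPerm_pairingIn _ k)),
      smul_eq_mul]
    ring
  rw [Base.isPos_iff] at hpos
  rw [z_eq_prod, extremalMonomial, extremalMonomial, sparseMonomial, sparseMonomial,
    ← Finset.prod_mul_distrib]
  refine Finset.prod_congr rfl fun l _ => ?_
  rw [hpair, hpm_eq_abs_height, hpm_eq_abs_height, hpm_eq_abs_height, hheight]
  rw [abs_of_pos hpos]
  by_cases hlj : l = j
  · subst hlj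
    rw [if_pos rfl, hj, P.pairingIn_same]
    rw [show b.height (w⁻¹ • (l : ι)) - 2 * b.height (w⁻¹ • (l : ι)) =
      -b.height (w⁻¹ • (l : ι)) by ring, abs_neg, abs_of_pos hpos]
    generalize b.height (w⁻¹ • (l : ι)) = h
    rw [show c - h - 1 + 2 = c - h + 1 by ring, show (1 : ℤ) - 2 = -1 by norm_num,
      show c - h + -1 = c - h - 1 by ring, zpow_neg, zpow_one, zpow_one, mul_comm (y l (c - h - 1)),
      mul_inv_cancel_right]
  · rw [if_neg hlj]
    have hc : b.cartanMatrix l j = P.pairingIn ℤ l j := rfl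
    rcases hsl hlj with h0 | h1
    · rw [if_neg (not_not.2 h0), ← hc, h0]
      simp
    · rw [if_pos (by rw [h1]; norm_num), ← hc, h1]
      have hA := hw.height_inv_smul_eq_one l
      have hA' := hw'.height_inv_smul_eq_one l
      have hm' := hi.pairing_smul (weylGroup.ofIdx P (j : ι) * w) l
      rw [hpair, ← hc, h1] at hm' hA'
      rw [hheight, ← hc, h1] at hA'
      generalize b.height (w⁻¹ • (j : ι)) = h at *
      generalize b.height (w⁻¹ • (l : ι)) = h' at *
      -- With pairing $-1$, the reflected weight is orthogonal to $\alpha_l$, so $h'+h=1$ and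
      -- $|h'|=h-1$. With pairing $0$, $h'=1$ and the reflected height is $h+1$. Pairing $1$ would
      -- become $2$ after reflection, against minusculeness.
      rcases hi.pairing_smul w l with hp | hp | hp
      · have := hA' (by lia)
        rw [hp, abs_of_nonpos (show h' ≤ 0 by lia)]
        rw [show (-1 : ℤ) - -1 = 0 by norm_num, zpow_zero, mul_one, zpow_neg, zpow_one,
          show c - h - 1 + 1 = c - -h' + -1 by lia]
      · have := hA hp
        rw [hp, abs_of_nonneg (show 0 ≤ h' - -1 * h by lia)]
        rw [show (0 : ℤ) - -1 = 1 by norm_num, zpow_zero, zpow_one,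
          show c - h - 1 + 1 = c - (h' - -1 * h) + 1 by lia, inv_mul_cancel]
      · lia

end Extremal

end MonomialCrystal
end

noncomputable section

namespace MonomialCrystal

open RootPairing

/-! ### The crystal consists exactly of the extremal monomials. -/

section FundamentalCrystal

variable {ι K M N : Type*} [Finite ι] [Field K] [CharZero K] [AddCommGroup M] [Module K M]
  [AddCommGroup N] [Module K N] {P : RootPairing ι K M N} [P.IsRootSystem]
  [P.IsCrystallographic] {b : P.Base} {par : b.support → ZMod 2}
  {i : b.support} {c : ℤ}

omit [Finite ι] [CharZero K] [P.IsRootSystem] in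
theorem parity_of_mem_fundamentalCrystal (hpar : IsBipartition b par)
    (hc : (c : ZMod 2) = par i) {a s : b.support → ℤ}
    (h : FundamentalCrystal b par i c (sparseMonomial a s)) {j : b.support} (hj : a j ≠ 0) :
    (s j : ZMod 2) = par j :=
  h.mem_parityMonomials b par hpar i c hc _ j (s j) (by rwa [expo_sparseMonomial])

variable [P.IsReduced]

/-- Membership in the crystal serves only to give the index at `j` the right parity, which avoids a
parity computation with heights. -/
theorem eTilde_extremalMonomial (hpar : IsBipartition b par) (hsl : b.cartanMatrix.IsSimplyLaced)
    (hi : IsMinuscule b i) (hc : (c : ZMod 2) = par i) {w : P.weylGroup}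
    (hw : PreservesLeviPos b i w)
    (h : FundamentalCrystal b par i c (extremalMonomial b i c w)) (j : b.support) :
    eTilde b par j (extremalMonomial b i c w) =
      if pairing (w • fundamentalCoweight b i) j = -1 then
        some (extremalMonomial b i c (weylGroup.ofIdx P (j : ι) * w)) else none := by
  split_ifs with hj
  · have hs := parity_of_mem_fundamentalCrystal hpar hc h (j := j) (by lia)
    have he : eps par j (extremalMonomial b i c w) = 1 := by
      rw [extremalMonomial, eps_sparseMonomial par hs, hj]
      rfl
    have hidx : eIndex par j (extremalMonomial b i c w) =
        c - hpm b (w⁻¹ • (j : ι)) + pairing (w • fundamentalCoweight b i) j :=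
      eIndex_sparseMonomial par (i := j) hs (by rw [hj]; norm_num)
    rw [eTilde, if_neg (by rw [he]; exact one_ne_zero), hidx]
    have hw' := hw.ofIdx_mul j (by lia)
    -- The reflected weight pairs to $+1$ with $\alpha_j$, so the identity applies to $s_jw$, and
    -- $s_js_jw=w$.
    have hstep := extremalMonomial_ofIdx_mul hsl hi c hw' j (by
      rw [weylGroup_mul_smul_coweight b, pairing_ofIdx_smul, hj, P.pairingIn_same]
      norm_num)
    rw [← mul_assoc, ofIdx_mul_self, one_mul] at hstep
    rw [← hstep]
    have hh : hpm b ((weylGroup.ofIdx P (j : ι) * w)⁻¹ • (j : ι)) = hpm b (w⁻¹ • (j : ι)) := by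
      rw [mul_inv_rev, mul_smul, ofIdx_inv, ofIdx_smul_eq, hpm_eq_abs_height, hpm_eq_abs_height,
        height_of_root_eq_neg b (m := w⁻¹ • (j : ι)), abs_neg]
      rw [root_weylGroup_smul, root_reflectionPerm_self', smul_neg, root_weylGroup_smul]
    rw [hh, hj, sub_eq_add_neg _ (1 : ℤ)]
  · rw [eTilde, if_pos]
    refine eps_sparseMonomial_eq_zero par ?_
    have := hi.pairing_smul w j
    lia

theorem fTilde_extremalMonomial (hpar : IsBipartition b par) (hsl : b.cartanMatrix.IsSimplyLaced)
    (hi : IsMinuscule b i) (hc : (c : ZMod 2) = par i) {w : P.weylGroup}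
    (hw : PreservesLeviPos b i w)
    (h : FundamentalCrystal b par i c (extremalMonomial b i c w)) (j : b.support) :
    fTilde b par j (extremalMonomial b i c w) =
      if pairing (w • fundamentalCoweight b i) j = 1 then
        some (extremalMonomial b i c (weylGroup.ofIdx P (j : ι) * w)) else none := by
  split_ifs with hj
  · have hs := parity_of_mem_fundamentalCrystal hpar hc h (j := j) (by lia)
    have he : phi par j (extremalMonomial b i c w) = 1 := by
      rw [extremalMonomial, phi_sparseMonomial par hs, hj]
      rfl
    have hidx : fIndex par j (extremalMonomial b i c w) =
        c - hpm b (w⁻¹ • (j : ι)) + pairing (w • fundamentalCoweight b i) j :=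
      fIndex_sparseMonomial par (i := j) hs (by rw [hj]; norm_num)
    rw [fTilde, if_neg (by rw [he]; exact one_ne_zero), hidx]
    rw [hj, show c - hpm b (w⁻¹ • (j : ι)) + 1 - 2 = c - hpm b (w⁻¹ • (j : ι)) - 1 by ring,
      ← extremalMonomial_ofIdx_mul hsl hi c hw j hj, inv_mul_cancel_left]
  · rw [fTilde, if_pos]
    refine phi_sparseMonomial_eq_zero par ?_
    have := hi.pairing_smul w j
    lia

/-- Every element of a minuscule fundamental crystal is an extremal monomial. -/
theorem FundamentalCrystal.exists_eq_extremalMonomial (hpar : IsBipartition b par)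
    (hsl : b.cartanMatrix.IsSimplyLaced) (hi : IsMinuscule b i) (hc : (c : ZMod 2) = par i)
    {p : Monomial b.support ℤ} (hp : FundamentalCrystal b par i c p) :
    ∃ w : P.weylGroup, PreservesLeviPos b i w ∧ p = extremalMonomial b i c w := by
  induction hp with
  | gen => exact ⟨1, preservesLeviPos_one, (extremalMonomial_one b i c).symm⟩
  | e j p q hp h ih =>
    obtain ⟨w, hw, rfl⟩ := ih
    rw [eTilde_extremalMonomial hpar hsl hi hc hw hp] at h
    split_ifs at h with hj
    exact ⟨_, hw.ofIdx_mul j (by lia), (Option.some.inj h).symm⟩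
  | f j p q hp h ih =>
    obtain ⟨w, hw, rfl⟩ := ih
    rw [fTilde_extremalMonomial hpar hsl hi hc hw hp] at h
    split_ifs at h with hj
    exact ⟨_, hw.ofIdx_mul j (by lia), (Option.some.inj h).symm⟩

/-- Letters that fix the current weight are skipped, so the element reached can differ from the
product of the word; only their values on $\varpi_i$ agree. -/
theorem exists_fundamentalCrystal_extremalMonomial (hpar : IsBipartition b par)
    (hsl : b.cartanMatrix.IsSimplyLaced) (hi : IsMinuscule b i) (hc : (c : ZMod 2) = par i)
    (l : List b.support) : ∃ w : P.weylGroup, PreservesLeviPos b i w ∧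
      w • fundamentalCoweight b i = wordProd b l • fundamentalCoweight b i ∧
      FundamentalCrystal b par i c (extremalMonomial b i c w) := by
  induction l with
  | nil =>
    refine ⟨1, preservesLeviPos_one, rfl, ?_⟩
    rw [extremalMonomial_one]
    exact .gen
  | cons j l ih =>
    obtain ⟨w, hw, hwl, hp⟩ := ih
    rw [wordProd_cons, weylGroup_mul_smul_coweight b, ← hwl]
    rcases hi.pairing_smul w j with hj | hj | hj
    · refine ⟨_, hw.ofIdx_mul j (by lia), weylGroup_mul_smul_coweight b _ _ _, hp.e j _ _ ?_⟩
      rw [eTilde_extremalMonomial hpar hsl hi hc hw hp, if_pos hj]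
    · exact ⟨w, hw, (ofIdx_smul_eq_self_of_pairing_eq_zero b _ _ hj).symm, hp⟩
    · refine ⟨_, hw.ofIdx_mul j (by lia), weylGroup_mul_smul_coweight b _ _ _, hp.f j _ _ ?_⟩
      rw [fTilde_extremalMonomial hpar hsl hi hc hw hp, if_pos hj]

theorem fundamentalCrystal_and_wt_eq_iff (hpar : IsBipartition b par)
    (hsl : b.cartanMatrix.IsSimplyLaced) (hi : IsMinuscule b i) (hc : (c : ZMod 2) = par i)
    {w : P.weylGroup} (hw : PreservesLeviPos b i w) (p : Monomial b.support ℤ) :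
    FundamentalCrystal b par i c p ∧ wt b p = w • fundamentalCoweight b i ↔
      p = extremalMonomial b i c w := by
  constructor
  · rintro ⟨hp, hwt⟩
    obtain ⟨v, hv, rfl⟩ := hp.exists_eq_extremalMonomial hpar hsl hi hc
    rw [wt_extremalMonomial] at hwt
    exact extremalMonomial_congr c hv hw hwt
  · rintro rfl
    refine ⟨?_, wt_extremalMonomial b i c w⟩
    obtain ⟨l, -, hl⟩ := exists_word_length_eq b w
    obtain ⟨v, hv, hvl, hp⟩ := exists_fundamentalCrystal_extremalMonomial hpar hsl hi hc l
    rw [hl] at hvl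
    rwa [← extremalMonomial_congr c hv hw hvl]

end FundamentalCrystal

end MonomialCrystal
end

open MonomialCrystal in
theorem mainTheorem12 {ι K M N : Type*} [Finite ι] [Field K] [CharZero K]
    [AddCommGroup M] [Module K M] [AddCommGroup N] [Module K N]
    (P : RootPairing ι K M N) [P.IsRootSystem] [P.IsCrystallographic] [P.IsReduced]
    (b : P.Base) (hsl : b.cartanMatrix.IsSimplyLaced)
    (par : b.support → ZMod 2) (hpar : IsBipartition b par)
    (i : b.support) (hi : IsMinuscule b i)
    (γ : coweightLattice P) (w : P.weylGroup)
    (hw : IsMinimalTaking b w (fundamentalCoweight b i) γ) :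
    (∀ c : ℤ, (c : ZMod 2) = par i →
      {p : Monomial b.support ℤ | FundamentalCrystal b par i c p ∧ wt b p = γ} =
        {∏ j : b.support, y j (c - hpm b (w⁻¹ • (j : ι)) + pairing γ j) ^ pairing γ j}) ∧
    (∀ c : ℂ,
      {p : Monomial b.support ℂ | ComplexFundamentalCrystal b par i c p ∧ wt b p = γ} =
        {∏ j : b.support,
          y j (c - (hpm b (w⁻¹ • (j : ι)) : ℂ) + (pairing γ j : ℂ)) ^ pairing γ j}) := by
  have hL := hw.preservesLeviPos
  obtain rfl := hw.1
  refine ⟨fun c hc => Set.ext fun p =>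
    fundamentalCrystal_and_wt_eq_iff hpar hsl hi hc hL p, fun c => Set.ext fun p => ?_⟩
  -- The base point $c_0$ cancels, so every admissible choice gives the same translated monomial.
  have htrans : ∀ c₀ : ℤ, translate (c - c₀) (extremalMonomial b i c₀ w) =
      ∏ j : b.support, y j (c - (hpm b (w⁻¹ • (j : ι)) : ℂ) +
        (pairing (w • fundamentalCoweight b i) j : ℂ)) ^
          pairing (w • fundamentalCoweight b i) j := by
    intro c₀
    rw [extremalMonomial, sparseMonomial, map_prod]
    refine Finset.prod_congr rfl fun j _ => ?_
    rw [map_zpow, translate_y]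
    congr 2
    push_cast
    ring
  constructor
  · rintro ⟨⟨c₀, hc₀, q, hq, rfl⟩, hwt⟩
    rw [wt_translate] at hwt
    rw [(fundamentalCrystal_and_wt_eq_iff hpar hsl hi hc₀ hL q).1 ⟨hq, hwt⟩]
    exact htrans c₀
  · intro hp
    obtain ⟨c₀, -, hc₀⟩ := exists_parity_ge par i 0
    obtain ⟨hq, hwt⟩ := (fundamentalCrystal_and_wt_eq_iff hpar hsl hi hc₀ hL _).2 rfl
    rw [Set.mem_singleton_iff.1 hp, ← htrans c₀]
    exact ⟨⟨c₀, hc₀, _, hq, rfl⟩, by rw [wt_translate, hwt]⟩
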